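/- Let $H$ be an infinite-dimensional complex Hilbert space. For a bounded linear operator $A$ on $H$, call $A$ Li-Yorke chaotic if there is $x\in H$ with $\limsup_{n\to\infty}\|A^n x\|>0$ (possibly $+\infty$) and $\liminf_{n\to\infty}\|A^n x\|=0$. For a bounded linear operator $T$ on $H$ put $S_{LY}(T)=\{\lambda\in\mathbb{C} : \lambda I+T \text{ is Li-Yorke chaotic}\}$. Then there is a bounded linear operator $T$ on $H$ such that $S_{LY}(T)$ is neither open nor closed in $\mathbb{C}$. -/

import Mathlib

open Filter

/-- `x` is a Li-Yorke chaotic point of the bounded operator `T`: the upper limit of `‖T ^ n x‖`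
is positive (possibly infinite) and its lower limit is zero.  The norms are taken with values in
`[0, ∞]`, where upper and lower limits of arbitrary sequences exist. -/
def IsLiYorkeChaoticPoint {E : Type*} [NormedAddCommGroup E] [NormedSpace ℂ E]
    (T : E →L[ℂ] E) (x : E) : Prop :=
  0 < limsup (fun n : ℕ => ‖(T ^ n) x‖ₑ) atTop ∧
    liminf (fun n : ℕ => ‖(T ^ n) x‖ₑ) atTop = 0

/-- A bounded operator is Li-Yorke chaotic if it has a Li-Yorke chaotic point. -/
def IsLiYorkeChaotic {E : Type*} [NormedAddCommGroup E] [NormedSpace ℂ E]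
    (T : E →L[ℂ] E) : Prop :=
  ∃ x : E, IsLiYorkeChaoticPoint T x

/-- `S_LY(T)`: the set of scalars `c` such that `c I + T` is Li-Yorke chaotic. -/
def liYorkeSet {E : Type*} [NormedAddCommGroup E] [NormedSpace ℂ E]
    (T : E →L[ℂ] E) : Set ℂ :=
  {c : ℂ | IsLiYorkeChaotic (c • ContinuousLinearMap.id ℂ E + T)}

open Topology

/-! Take `T` to be a direct sum of 2×2 Jordan blocks with real eigenvalues; translating by `c`
translates the eigenvalues. If eigenvalues in `(0, 1)` tend to `1`, single blocks have decaying
orbits with arbitrarily large transients, and Baire category yields a chaotic point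
(`IsJordanSum.isLiYorkeChaotic`). If only finitely many eigenvalues lie in the open unit disc, every
orbit tends to zero or is bounded below (`IsJordanSum.not_isLiYorkeChaotic`).

Eigenvalues increasing to `0` make `c = 1` chaotic, but no `1 + ε`: not open. Eigenvalues increasing
to each `4 + 1 / (i + 1)` make `-3 - 1 / (i + 1)` chaotic, but not the limit `-3`: not closed. -/

theorem isLiYorkeChaotic_of_tendsto_of_unbounded {E : Type*} [NormedAddCommGroup E]
    [NormedSpace ℂ E] [CompleteSpace E] (A : E →L[ℂ] E) (S : Set E)
    (h0 : ∀ v ∈ S, Tendsto (fun n : ℕ => (A ^ n) v) atTop (𝓝 0))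
    (h1 : ∀ C : ℝ, ∃ v ∈ S, ‖v‖ = 1 ∧ ∃ n : ℕ, C < ‖(A ^ n) v‖) :
    IsLiYorkeChaotic A := by
  set M : Submodule ℂ E := Submodule.span ℂ S
  have hspan : ∀ v ∈ M, Tendsto (fun n : ℕ => (A ^ n) v) atTop (𝓝 0) := by
    intro v hv
    induction hv using Submodule.span_induction with
    | mem x hx => exact h0 x hx
    | zero => simp
    | add x y _ _ hx hy => simpa using hx.add hy
    | smul c x _ hx => simpa using hx.const_smul c
  have : CompleteSpace M.topologicalClosure :=
    M.isClosed_topologicalClosure.completeSpace_coe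
  -- Baire on the closed span of `S`: a point in every `U m` has an unbounded orbit, one in every `V
  -- m` has orbit norms with lower limit zero.
  let U : ℕ → Set M.topologicalClosure := fun m => {x | ∃ n : ℕ, (m : ℝ) < ‖(A ^ n) (x : E)‖}
  let V : ℕ → Set M.topologicalClosure :=
    fun m => {x | ∃ n : ℕ, m ≤ n ∧ ‖(A ^ n) (x : E)‖ < ((m : ℝ) + 1)⁻¹}
  have hcont : ∀ n : ℕ, Continuous fun x : M.topologicalClosure => ‖(A ^ n) (x : E)‖ :=
    fun n => ((A ^ n).continuous.comp continuous_subtype_val).norm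
  have hUo : ∀ m, IsOpen (U m) := by
    intro m
    have : U m = ⋃ n : ℕ, {x : M.topologicalClosure | (m : ℝ) < ‖(A ^ n) (x : E)‖} := by ext; simp [U]
    rw [this]
    exact isOpen_iUnion fun n => isOpen_lt continuous_const (hcont n)
  have hVo : ∀ m, IsOpen (V m) := by
    intro m
    have : V m = ⋃ n : ℕ, ⋃ _ : m ≤ n,
        {x : M.topologicalClosure | ‖(A ^ n) (x : E)‖ < ((m : ℝ) + 1)⁻¹} := by
      ext; simp [V]
    rw [this]
    exact isOpen_iUnion fun n => isOpen_iUnion fun _ => isOpen_lt (hcont n) continuous_const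
  have hVd : ∀ m, Dense (V m) := by
    intro m x
    rw [Metric.mem_closure_iff]
    intro ε hε
    obtain ⟨y, hy, hxy⟩ := Metric.mem_closure_iff.1 x.2 ε hε
    refine ⟨⟨y, M.le_topologicalClosure hy⟩, ?_, hxy⟩
    have hlim := (hspan y hy).norm
    rw [norm_zero] at hlim
    obtain ⟨n, hn, hmn⟩ := ((hlim.eventually_lt_const
      (by positivity : (0 : ℝ) < ((m : ℝ) + 1)⁻¹)).and (eventually_ge_atTop m)).exists
    exact ⟨n, hmn, hn⟩
  have hUd : ∀ m, Dense (U m) := by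
    intro m x
    rw [Metric.mem_closure_iff]
    intro ε hε
    by_contra! hcon
    have hbound : ∀ y : M.topologicalClosure, dist x y < ε → ∀ n : ℕ, ‖(A ^ n) (y : E)‖ ≤ m := by
      intro y hy n
      by_contra! h
      exact absurd (hcon y ⟨n, h⟩) (not_le.2 hy)
    -- Orbits bounded by `m` on an `ε`-ball force `(ε / 2) * ‖(A ^ n) v‖ ≤ 2 * m` for unit `v`.
    obtain ⟨v, hvS, hv1, n, hn⟩ := h1 (4 * m / ε)
    let v' : M.topologicalClosure := ⟨v, M.le_topologicalClosure (Submodule.subset_span hvS)⟩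
    have hv' : ‖v'‖ = 1 := hv1
    have hx := hbound x (by simpa using hε) n
    have hy := hbound (x + ((ε / 2 : ℝ) : ℂ) • v') (by
      rw [dist_eq_norm, sub_add_cancel_left, norm_neg, norm_smul, hv', Complex.norm_real,
        Real.norm_of_nonneg (by positivity)]
      linarith) n
    have hsub : ((ε / 2 : ℝ) : ℂ) • (A ^ n) v =
        (A ^ n) ((x + ((ε / 2 : ℝ) : ℂ) • v' : M.topologicalClosure) : E) - (A ^ n) (x : E) := by
      rw [Submodule.coe_add, Submodule.coe_smul, map_add, map_smul, add_sub_cancel_left]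
    have hle := norm_sub_le
      ((A ^ n) ((x + ((ε / 2 : ℝ) : ℂ) • v' : M.topologicalClosure) : E)) ((A ^ n) (x : E))
    rw [← hsub, norm_smul, Complex.norm_real, Real.norm_of_nonneg (by positivity)] at hle
    rw [div_lt_iff₀ hε] at hn
    linarith
  have hdense : Dense (⋂ m, U m ∩ V m) := by
    refine dense_iInter_of_isOpen_nat (fun m => (hUo m).inter (hVo m)) fun m => ?_
    exact (hUd m).inter_of_isOpen_left (hVd m) (hUo m)
  obtain ⟨x, hx⟩ := hdense.nonempty
  rw [Set.mem_iInter] at hx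
  refine ⟨x, ?_, ?_⟩
  · have hfreq : ∃ᶠ n : ℕ in atTop, (1 : ENNReal) ≤ ‖(A ^ n) (x : E)‖ₑ := by
      rw [Filter.Frequently]
      intro hev
      obtain ⟨N, hN⟩ := eventually_atTop.1 hev
      obtain ⟨C, hC⟩ := ((Finset.range N).image fun n => ‖(A ^ n) (x : E)‖).bddAbove
      obtain ⟨m, hm⟩ := exists_nat_gt (max C 1)
      obtain ⟨n, hn⟩ := (hx m).1
      rcases lt_or_ge n N with h | h
      · have := hC (Finset.mem_coe.2 (Finset.mem_image_of_mem _ (Finset.mem_range.2 h)))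
        exact absurd ((le_max_left C 1).trans_lt hm) (not_lt.2 (hn.le.trans this))
      · refine hN n h ?_
        rw [← ofReal_norm, ENNReal.one_le_ofReal]
        exact ((le_max_right C 1).trans hm.le).trans hn.le
    exact zero_lt_one.trans_le (le_limsup_of_frequently_le hfreq)
  · rw [← nonpos_iff_eq_zero]
    refine ENNReal.le_of_forall_pos_le_add fun ε hε _ => ?_
    rw [zero_add]
    refine liminf_le_of_frequently_le (frequently_atTop.2 fun N => ?_)
    obtain ⟨m, hm⟩ := exists_nat_one_div_lt (NNReal.coe_pos.2 hε)
    obtain ⟨n, hn, hlt⟩ := (hx (max m N)).2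
    refine ⟨n, (le_max_right _ _).trans hn, ?_⟩
    rw [← ofReal_norm, ← ENNReal.ofReal_coe_nnreal]
    refine ENNReal.ofReal_le_ofReal (hlt.le.trans (le_trans ?_ hm.le))
    rw [one_div]
    gcongr
    exact le_max_left _ _

theorem not_isLiYorkeChaotic_of_dichotomy {E : Type*} [NormedAddCommGroup E] [NormedSpace ℂ E]
    (A : E →L[ℂ] E)
    (h : ∀ x, (∃ c > 0, ∀ n : ℕ, c ≤ ‖(A ^ n) x‖) ∨
      Tendsto (fun n : ℕ => (A ^ n) x) atTop (𝓝 0)) :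
    ¬ IsLiYorkeChaotic A := by
  rintro ⟨x, hsup, hinf⟩
  rcases h x with ⟨c, hc, hle⟩ | hlim
  · have : ENNReal.ofReal c ≤ liminf (fun n : ℕ => ‖(A ^ n) x‖ₑ) atTop := by
      refine le_liminf_of_le (h := Eventually.of_forall fun n => ?_)
      rw [← ofReal_norm]
      exact ENNReal.ofReal_le_ofReal (hle n)
    rw [hinf, nonpos_iff_eq_zero, ENNReal.ofReal_eq_zero] at this
    exact absurd hc (not_lt.2 this)
  · have := hlim.enorm
    rw [enorm_zero] at this
    rw [this.limsup_eq] at hsup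
    exact lt_irrefl _ hsup

/-! ### Direct sums of Jordan blocks -/

theorem exists_weightedComposition {ι : Type*} (m : ι → ℂ) (g : ι ≃ ι) (C : ℝ)
    (hm : ∀ i, ‖m i‖ ≤ C) :
    ∃ W : lp (fun _ : ι => ℂ) 2 →L[ℂ] lp (fun _ : ι => ℂ) 2,
      ∀ x i, W x i = m i * x (g i) := by
  have hsq : ∀ (x : lp (fun _ : ι => ℂ) 2) i,
      ‖m i * x (g i)‖ ^ 2 ≤ C ^ 2 * ‖x (g i)‖ ^ 2 := by
    intro x i
    rw [norm_mul, mul_pow]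
    gcongr
    exact hm i
  have hnorm : ∀ x : lp (fun _ : ι => ℂ) 2, HasSum (fun i => ‖x (g i)‖ ^ 2) (‖x‖ ^ 2) := by
    intro x
    have := lp.hasSum_norm (p := 2) (by norm_num) x
    simp only [ENNReal.toReal_ofNat, Real.rpow_ofNat] at this
    exact (g.hasSum_iff (f := fun i => ‖x i‖ ^ 2)).2 this
  have hmem : ∀ x : lp (fun _ : ι => ℂ) 2, Memℓp (fun i => m i * x (g i)) 2 := by
    intro x
    refine memℓp_gen ?_
    simp only [ENNReal.toReal_ofNat, Real.rpow_ofNat]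
    exact Summable.of_nonneg_of_le (fun i => by positivity) (hsq x)
      ((hnorm x).summable.mul_left _)
  let L : lp (fun _ : ι => ℂ) 2 →ₗ[ℂ] lp (fun _ : ι => ℂ) 2 :=
    { toFun := fun x => ⟨fun i => m i * x (g i), hmem x⟩
      map_add' := fun x y => by
        ext i
        exact mul_add _ _ _
      map_smul' := fun c x => by
        ext i
        exact mul_left_comm _ _ _ }
  refine ⟨L.mkContinuous |C| fun x => ?_, fun x i => rfl⟩
  have h1 := lp.hasSum_norm (p := 2) (by norm_num) (L x)
  simp only [ENNReal.toReal_ofNat, Real.rpow_ofNat] at h1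
  have h2 := hasSum_le (hsq x) h1 ((hnorm x).mul_left _)
  rw [← mul_pow] at h2
  have h3 := sq_le_sq.1 h2
  rwa [abs_norm, abs_mul, abs_norm] at h3

/-- In the basis `b`, the operator `A` is the direct sum of the Jordan blocks of size two with
eigenvalues `a k`. -/
def IsJordanSum {H κ : Type*} [NormedAddCommGroup H] [InnerProductSpace ℂ H]
    (b : HilbertBasis (κ × Bool) ℂ H) (A : H →L[ℂ] H) (a : κ → ℂ) : Prop :=
  ∀ x k, b.repr (A x) (k, true) = a k * b.repr x (k, true) ∧
    b.repr (A x) (k, false) = a k * b.repr x (k, false) + b.repr x (k, true)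

theorem exists_isJordanSum {H κ : Type*} [NormedAddCommGroup H] [InnerProductSpace ℂ H]
    (b : HilbertBasis (κ × Bool) ℂ H) (a : κ → ℂ) (C : ℝ) (ha : ∀ k, ‖a k‖ ≤ C) :
    ∃ A : H →L[ℂ] H, IsJordanSum b A a := by
  obtain ⟨D, hD⟩ := exists_weightedComposition (fun i : κ × Bool => a i.1) (Equiv.refl _) C
    (fun i => ha i.1)
  obtain ⟨N, hN⟩ := exists_weightedComposition
    (fun i : κ × Bool => if i.2 then (0 : ℂ) else 1)
    (Equiv.prodCongr (Equiv.refl κ) Equiv.boolNot) 1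
    (fun i => by split_ifs <;> simp)
  refine ⟨(b.repr.symm.toContinuousLinearEquiv : _ →L[ℂ] H) ∘L (D + N) ∘L
    (b.repr.toContinuousLinearEquiv : H →L[ℂ] _), fun x k => ⟨?_, ?_⟩⟩ <;>
  simp [hD, hN]

namespace IsJordanSum

variable {H κ : Type*} [NormedAddCommGroup H] [InnerProductSpace ℂ H]
  {b : HilbertBasis (κ × Bool) ℂ H} {A : H →L[ℂ] H} {a : κ → ℂ}

theorem smul_id_add (h : IsJordanSum b A a) (c : ℂ) :
    IsJordanSum b (c • ContinuousLinearMap.id ℂ H + A) (fun k => c + a k) := by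
  intro x k
  have hrepr : ∀ i, b.repr ((c • ContinuousLinearMap.id ℂ H + A) x) i =
      c * b.repr x i + b.repr (A x) i := fun i => by
    rw [add_apply, smul_apply,
      ContinuousLinearMap.id_apply, map_add, map_smul]
    rfl
  constructor
  · rw [hrepr, (h x k).1]
    ring
  · rw [hrepr, (h x k).2]
    ring

theorem repr_pow_true (h : IsJordanSum b A a) (x : H) (k : κ) (n : ℕ) :
    b.repr ((A ^ n) x) (k, true) = a k ^ n * b.repr x (k, true) := by
  induction n with
  | zero => simp
  | succ n ih =>
    rw [pow_succ', mul_apply_eq_comp, (h _ k).1, ih]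
    ring

theorem repr_pow_false (h : IsJordanSum b A a) (x : H) (k : κ) (n : ℕ) :
    b.repr ((A ^ n) x) (k, false) =
      a k ^ n * b.repr x (k, false) + n * a k ^ (n - 1) * b.repr x (k, true) := by
  induction n with
  | zero => simp
  | succ n ih =>
    rw [pow_succ', mul_apply_eq_comp, (h _ k).2, ih, h.repr_pow_true]
    cases n with
    | zero => simp
    | succ n =>
      simp only [Nat.add_sub_cancel]
      push_cast
      ring

theorem pow_apply_true (h : IsJordanSum b A a) (k : κ) (n : ℕ) :
    (A ^ n) (b (k, true)) = a k ^ n • b (k, true) + (n * a k ^ (n - 1)) • b (k, false) := by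
  classical
  apply b.repr.injective
  ext ⟨l, j⟩
  rw [map_add, map_smul, map_smul, b.repr_self, b.repr_self]
  change _ = a k ^ n * lp.single (E := fun _ : κ × Bool => ℂ) 2 (k, true) 1 (l, j) +
    (n * a k ^ (n - 1)) * lp.single (E := fun _ : κ × Bool => ℂ) 2 (k, false) 1 (l, j)
  cases j
  · rw [h.repr_pow_false, b.repr_self]
    rcases eq_or_ne l k with rfl | hl <;> simp [*]
  · rw [h.repr_pow_true, b.repr_self]
    rcases eq_or_ne l k with rfl | hl <;> simp [*]

theorem pow_apply_false (h : IsJordanSum b A a) (k : κ) (n : ℕ) :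
    (A ^ n) (b (k, false)) = a k ^ n • b (k, false) := by
  classical
  apply b.repr.injective
  ext ⟨l, j⟩
  rw [map_smul, b.repr_self]
  change _ = a k ^ n * lp.single (E := fun _ : κ × Bool => ℂ) 2 (k, false) 1 (l, j)
  cases j
  · rw [h.repr_pow_false, b.repr_self]
    rcases eq_or_ne l k with rfl | hl <;> simp [*]
  · rw [h.repr_pow_true, b.repr_self]
    simp

theorem tendsto_pow_apply_basis (h : IsJordanSum b A a) {k : κ} (hk : ‖a k‖ < 1) (j : Bool) :
    Tendsto (fun n : ℕ => (A ^ n) (b (k, j))) atTop (𝓝 0) := by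
  have h0 := tendsto_pow_atTop_nhds_zero_of_norm_lt_one hk
  cases j with
  | false => simpa [h.pow_apply_false] using h0.smul_const (b (k, false))
  | true =>
    have h1 : Tendsto (fun n : ℕ => (n : ℂ) * a k ^ (n - 1)) atTop (𝓝 0) := by
      rw [← tendsto_add_atTop_iff_nat 1]
      simpa [add_mul] using
        (summable_pow_mul_geometric_of_norm_lt_one 1 hk).tendsto_atTop_zero.add h0
    simpa [h.pow_apply_true] using (h0.smul_const (b (k, true))).add (h1.smul_const (b (k, false)))

theorem norm_repr_le (b : HilbertBasis (κ × Bool) ℂ H) (x : H) (i : κ × Bool) :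
    ‖b.repr x i‖ ≤ ‖x‖ :=
  (lp.norm_apply_le_norm (by norm_num) _ _).trans_eq (b.repr.norm_map x)

/-- A nonzero component in a block with `1 ≤ ‖a k‖` keeps the orbit away from zero; otherwise `x` is
a finite combination of basis vectors with decaying orbits. -/
theorem not_isLiYorkeChaotic (h : IsJordanSum b A a) (ha : {k | ‖a k‖ < 1}.Finite) :
    ¬ IsLiYorkeChaotic A := by
  refine not_isLiYorkeChaotic_of_dichotomy A fun x => ?_
  by_cases hx : ∃ k, 1 ≤ ‖a k‖ ∧ ∃ j, b.repr x (k, j) ≠ 0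
  · left
    obtain ⟨k, hk, j, hj⟩ := hx
    by_cases ht : b.repr x (k, true) = 0
    · have hf : b.repr x (k, false) ≠ 0 := by
        cases j with
        | false => exact hj
        | true => exact absurd ht hj
      refine ⟨_, norm_pos_iff.2 hf, fun n => le_trans ?_ (norm_repr_le b _ (k, false))⟩
      rw [h.repr_pow_false, ht, mul_zero, add_zero, norm_mul, norm_pow]
      exact le_mul_of_one_le_left (norm_nonneg _) (one_le_pow₀ hk)
    · refine ⟨_, norm_pos_iff.2 ht, fun n => le_trans ?_ (norm_repr_le b _ (k, true))⟩
      rw [h.repr_pow_true, norm_mul, norm_pow]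
      exact le_mul_of_one_le_left (norm_nonneg _) (one_le_pow₀ hk)
  · right
    push Not at hx
    let F : Finset (κ × Bool) := ha.toFinset ×ˢ Finset.univ
    have hxF : x = ∑ i ∈ F, b.repr x i • b i := by
      refine (b.hasSum_repr x).unique (hasSum_sum_of_ne_finset_zero fun i hi => ?_)
      have : 1 ≤ ‖a i.1‖ := by simpa [F] using hi
      rw [hx i.1 this i.2, zero_smul]
    rw [hxF]
    have : ∀ i ∈ F, Tendsto (fun n : ℕ => b.repr x i • (A ^ n) (b i)) atTop (𝓝 0) := by
      intro i hi
      have hi' : ‖a i.1‖ < 1 := by simpa [F] using hi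
      simpa using (h.tendsto_pow_apply_basis hi' i.2).const_smul (b.repr x i)
    simpa only [map_sum, map_smul, Finset.sum_const_zero] using tendsto_finsetSum F this

theorem isLiYorkeChaotic [CompleteSpace H] (h : IsJordanSum b A a) (f : ℕ → κ) (δ : ℕ → ℝ)
    (hδ : ∀ j, 0 < δ j) (hδ1 : ∀ j, δ j < 1) (hlim : Tendsto δ atTop (𝓝 0))
    (haf : ∀ j, a (f j) = ((1 - δ j : ℝ) : ℂ)) :
    IsLiYorkeChaotic A := by
  have hnorm : ∀ j, ‖a (f j)‖ = 1 - δ j := fun j => by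
    rw [haf, Complex.norm_real, Real.norm_of_nonneg (by linarith [hδ1 j])]
  refine isLiYorkeChaotic_of_tendsto_of_unbounded A (Set.range fun j => b (f j, true)) ?_ ?_
  · rintro _ ⟨j, rfl⟩
    exact h.tendsto_pow_apply_basis (by linarith [hnorm j, hδ j]) true
  · intro C
    obtain ⟨n, hn⟩ := exists_nat_gt (max (2 * C) 0)
    have hn0 : (0 : ℝ) < n := (le_max_right _ _).trans_lt hn
    obtain ⟨j, hj⟩ := (hlim.eventually_lt_const
      (by positivity : (0 : ℝ) < (2 * n : ℝ)⁻¹)).exists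
    refine ⟨_, ⟨j, rfl⟩, b.orthonormal.1 _, n, ?_⟩
    refine lt_of_lt_of_le ?_ (norm_repr_le b _ (f j, false))
    classical
    have hval : ‖b.repr ((A ^ n) (b (f j, true))) (f j, false)‖ = n * (1 - δ j) ^ (n - 1) := by
      rw [h.repr_pow_false, b.repr_self]
      simp [hnorm j]
    rw [hval]
    -- Bernoulli, with `j` chosen so that `n * δ j ≤ 1 / 2`.
    have hpow : 1 / 2 ≤ (1 - δ j) ^ (n - 1) := by
      have h1 := one_add_mul_le_pow (a := -δ j) (by linarith [hδ1 j]) (n - 1)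
      have h2 : ((n - 1 : ℕ) : ℝ) ≤ n := by exact_mod_cast Nat.sub_le n 1
      have h3 : n * δ j ≤ 1 / 2 := by
        have := mul_le_mul_of_nonneg_left hj.le hn0.le
        rwa [mul_inv, mul_comm (2⁻¹ : ℝ), ← mul_assoc, mul_inv_cancel₀ hn0.ne', one_mul,
          ← one_div] at this
      have h4 := mul_le_mul_of_nonneg_right h2 (hδ j).le
      rw [← sub_eq_add_neg] at h1
      linarith
    have := mul_le_mul_of_nonneg_left hpow hn0.le
    linarith [(le_max_left (2 * C) 0).trans_lt hn]

end IsJordanSum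

/-! ### The operator -/

theorem exists_hilbertBasis_prod_bool (H : Type*) [NormedAddCommGroup H]
    [InnerProductSpace ℂ H] [CompleteSpace H] (hH : ¬ FiniteDimensional ℂ H) :
    ∃ w : Set H, Infinite w ∧ Nonempty (HilbertBasis (w × Bool) ℂ H) := by
  obtain ⟨w, b, -⟩ := exists_hilbertBasis ℂ H
  have hw : Infinite w := by
    by_contra hfin
    rw [not_infinite_iff_finite] at hfin
    have := Fintype.ofFinite w
    exact hH b.toOrthonormalBasis.toBasis.finiteDimensional_of_finite
  have hcard : Cardinal.mk (w × Bool) = Cardinal.mk w := by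
    rw [Cardinal.mk_prod, Cardinal.lift_uzero, Cardinal.mk_bool, Cardinal.lift_ofNat]
    exact Cardinal.mul_eq_left (Cardinal.aleph0_le_mk w)
      ((Cardinal.ofNat_lt_aleph0.le).trans (Cardinal.aleph0_le_mk w)) two_ne_zero
  obtain ⟨e⟩ := Cardinal.eq.1 hcard
  refine ⟨w, hw, ⟨HilbertBasis.mk (b.orthonormal.comp e e.injective) ?_⟩⟩
  rw [e.surjective.range_comp, b.dense_span]

/-- Eigenvalues accumulating at `0` and, from above, at the points `4 + 1 / (i + 1)`. -/
noncomputable def blockEigenvalue : ℕ ⊕ ℕ × ℕ → ℝ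
  | .inl j => -((j : ℝ) + 2)⁻¹
  | .inr p => 4 + ((p.1 : ℝ) + 1)⁻¹ - ((p.1 : ℝ) + 1)⁻¹ * ((p.2 : ℝ) + 2)⁻¹

theorem inv_nat_add_two_mem (j : ℕ) : 0 < ((j : ℝ) + 2)⁻¹ ∧ ((j : ℝ) + 2)⁻¹ < 1 := by
  have : (0 : ℝ) ≤ j := j.cast_nonneg
  exact ⟨by positivity, inv_lt_one_of_one_lt₀ (by linarith)⟩

theorem tendsto_inv_nat_add (c : ℝ) : Tendsto (fun j : ℕ => ((j : ℝ) + c)⁻¹) atTop (𝓝 0) :=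
  (tendsto_atTop_add_const_right _ c tendsto_natCast_atTop_atTop).inv_tendsto_atTop

theorem blockEigenvalue_inr_mem (p : ℕ × ℕ) :
    4 ≤ blockEigenvalue (.inr p) ∧ blockEigenvalue (.inr p) ≤ 5 := by
  have h1 : (0 : ℝ) < ((p.1 : ℝ) + 1)⁻¹ := by positivity
  have h2 : ((p.1 : ℝ) + 1)⁻¹ ≤ 1 := inv_le_one_of_one_le₀ (by simp)
  obtain ⟨h3, h4⟩ := inv_nat_add_two_mem p.2
  have h5 := mul_lt_mul_of_pos_left h4 h1
  have h6 := mul_pos h1 h3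
  simp only [blockEigenvalue]
  constructor <;> linarith

theorem theorem12 {H : Type*} [NormedAddCommGroup H] [InnerProductSpace ℂ H] [CompleteSpace H]
    (hH : ¬ FiniteDimensional ℂ H) :
    ∃ T : H →L[ℂ] H, ¬ IsOpen (liYorkeSet T) ∧ ¬ IsClosed (liYorkeSet T) := by
  obtain ⟨κ, hκ, ⟨b⟩⟩ := exists_hilbertBasis_prod_bool H hH
  let φ : ℕ ⊕ ℕ × ℕ ↪ κ := (Denumerable.eqv _).toEmbedding.trans (Infinite.natEmbedding κ)
  -- The default `4` keeps spare blocks outside the open unit disc for `c = 1 + ε` and `c = -3`.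
  let t : κ → ℝ := Function.extend φ blockEigenvalue fun _ => 4
  have htφ : ∀ q, t (φ q) = blockEigenvalue q := fun q => φ.injective.extend_apply _ _ q
  have hcases : ∀ k, (∃ j, k = φ (.inl j)) ∨ (4 ≤ t k ∧ t k ≤ 5) := by
    intro k
    by_cases hk : ∃ q, φ q = k
    · obtain ⟨q | q, rfl⟩ := hk
      · exact Or.inl ⟨q, rfl⟩
      · rw [htφ]
        exact Or.inr (blockEigenvalue_inr_mem q)
    · have : t k = 4 := Function.extend_apply' _ _ _ hk
      right
      constructor <;> linarith
  obtain ⟨T, hT⟩ := exists_isJordanSum b (fun k => (t k : ℂ)) 5 (fun k => by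
    rw [Complex.norm_real, Real.norm_eq_abs, abs_le]
    rcases hcases k with ⟨j, rfl⟩ | hk
    · rw [htφ]
      obtain ⟨h1, h2⟩ := inv_nat_add_two_mem j
      simp only [blockEigenvalue]
      constructor <;> linarith
    · constructor <;> linarith)
  have hnorm : ∀ (c : ℝ) k, ‖(c : ℂ) + (t k : ℂ)‖ = |c + t k| := fun c k => by
    rw [← Complex.ofReal_add, Complex.norm_real, Real.norm_eq_abs]
  have h_one : (1 : ℂ) ∈ liYorkeSet T := by
    refine (hT.smul_id_add 1).isLiYorkeChaotic (fun j => φ (.inl j)) (fun j => ((j : ℝ) + 2)⁻¹)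
      (fun j => (inv_nat_add_two_mem j).1) (fun j => (inv_nat_add_two_mem j).2)
      (tendsto_inv_nat_add 2) fun j => ?_
    simp [htφ, blockEigenvalue, sub_eq_add_neg]
  have h_near_one : ∀ ε : ℝ, 0 < ε → ((1 + ε : ℝ) : ℂ) ∉ liYorkeSet T := by
    intro ε hε
    refine (hT.smul_id_add _).not_isLiYorkeChaotic ?_
    have hfin : {j : ℕ | ε < ((j : ℝ) + 2)⁻¹}.Finite := by
      have := (tendsto_inv_nat_add 2).eventually_le_const hε
      rw [← Nat.cofinite_eq_atTop, eventually_cofinite] at this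
      simpa using this
    refine (hfin.image fun j => φ (.inl j)).subset fun k hk => ?_
    rw [Set.mem_ofPred_eq, hnorm, abs_lt] at hk
    rcases hcases k with ⟨j, rfl⟩ | h
    · refine ⟨j, ?_, rfl⟩
      rw [htφ] at hk
      simp only [blockEigenvalue] at hk
      rw [Set.mem_ofPred_eq]
      linarith
    · linarith
  have h_seq : ∀ i : ℕ, ((-3 - ((i : ℝ) + 1)⁻¹ : ℝ) : ℂ) ∈ liYorkeSet T := by
    intro i
    have hi : (0 : ℝ) < ((i : ℝ) + 1)⁻¹ := by positivity
    have hi1 : ((i : ℝ) + 1)⁻¹ ≤ 1 := inv_le_one_of_one_le₀ (by simp)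
    refine (hT.smul_id_add _).isLiYorkeChaotic (fun j => φ (.inr (i, j)))
      (fun j => ((i : ℝ) + 1)⁻¹ * ((j : ℝ) + 2)⁻¹)
      (fun j => mul_pos hi (inv_nat_add_two_mem j).1)
      (fun j => mul_lt_one_of_nonneg_of_lt_one_right hi1 (inv_nat_add_two_mem j).1.le
        (inv_nat_add_two_mem j).2)
      (by simpa using (tendsto_inv_nat_add 2).const_mul ((i : ℝ) + 1)⁻¹) fun j => ?_
    rw [← Complex.ofReal_add, htφ]
    congr 1
    simp only [blockEigenvalue]
    ring
  have h_limit : ((-3 : ℝ) : ℂ) ∉ liYorkeSet T := by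
    refine (hT.smul_id_add _).not_isLiYorkeChaotic ?_
    refine Set.finite_empty.subset fun k hk => ?_
    rw [Set.mem_ofPred_eq, hnorm, abs_lt] at hk
    rcases hcases k with ⟨j, rfl⟩ | h
    · rw [htφ] at hk
      simp only [blockEigenvalue] at hk
      linarith [(inv_nat_add_two_mem j).1]
    · linarith
  refine ⟨T, fun hopen => ?_, fun hclosed => h_limit ?_⟩
  · have hlim : Tendsto (fun j : ℕ => ((1 + ((j : ℝ) + 1)⁻¹ : ℝ) : ℂ)) atTop (𝓝 1) := by
      have := (Complex.continuous_ofReal.tendsto _).comp ((tendsto_inv_nat_add 1).const_add 1)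
      simpa only [Function.comp_def, add_zero, Complex.ofReal_one] using this
    obtain ⟨j, hj⟩ := (hlim.eventually_mem (hopen.mem_nhds h_one)).exists
    exact h_near_one _ (by positivity) hj
  · have hlim : Tendsto (fun i : ℕ => ((-3 - ((i : ℝ) + 1)⁻¹ : ℝ) : ℂ)) atTop
        (𝓝 ((-3 : ℝ) : ℂ)) := by
      have := (Complex.continuous_ofReal.tendsto _).comp ((tendsto_inv_nat_add 1).const_sub (-3))
      simpa only [Function.comp_def, sub_zero] using this
    exact hclosed.mem_of_tendsto hlim (Eventually.of_forall h_seq)
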